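/- Let $G$ be a group. A trace-preserving $G$-von Neumann algebra $(\mathcal M,\tau_{\mathcal M})$ is a von Neumann algebra $\mathcal M$ with a faithful normal tracial state $\tau_{\mathcal M}$ and an action of $G$ on $\mathcal M$ by $*$-automorphisms that preserve $\tau_{\mathcal M}$; the action is ergodic if the only $G$-fixed elements of $\mathcal M$ are the scalars $\mathbb C1$. Let $(\mathcal M,\tau_{\mathcal M})$ and $(\mathcal N,\tau_{\mathcal N})$ be trace-preserving $G$-von Neumann algebras whose actions are both ergodic. Let $\mathcal P=\mathcal M\bar\otimes\mathcal N$ be the von Neumann algebra tensor product with the diagonal action of $G$, determined by $g(m\otimes n)=gm\otimes gn$, and identify $\mathcal M$ with $\mathcal M\otimes 1\subseteq\mathcal P$. Let $q$ be an element of the center $\mathcal Z(\mathcal P)$ such that the ideal $I=q\mathcal P$ is $G$-invariant and non-trivial, i.e. $I\ne\{0\}$ and $I\neq\mathcal P$. Suppose that $\mathcal M$ is abelian (that is, $(\mathcal M,\tau_{\mathcal M})\cong L^\infty(X,\nu)$ for a probability space $(X,\nu)$) and that $\mathcal N$ is non-commutative. Then $$\mathcal V_{I,\mathcal M}=\mathcal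 M+q\mathcal P$$ does not split: there is no $G$-invariant von Neumann subalgebra $\mathcal N_0\subseteq\mathcal N$ with $\mathcal M+q\mathcal P=\mathcal M\bar\otimes\mathcal N_0$. -/

import Mathlib

open scoped TensorProduct InnerProductSpace

noncomputable section

namespace ErgodicVNA

/-! ### Generated von Neumann algebras and von Neumann tensor products -/

section Tensor

variable {E F : Type*} [NormedAddCommGroup E] [InnerProductSpace ℂ E]
  [NormedAddCommGroup F] [InnerProductSpace ℂ F]

/-- The von Neumann algebra on `E` generated by a set `S` of bounded operators: the double
commutant of `S ∪ S*`. -/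
def generated [CompleteSpace E] (S : Set (E →L[ℂ] E)) : VonNeumannAlgebra E where
  toStarSubalgebra := StarSubalgebra.centralizer ℂ (StarSubalgebra.centralizer ℂ S : Set (E →L[ℂ] E))
  centralizer_centralizer' := by
    change Set.centralizer (Set.centralizer
      ((StarSubalgebra.centralizer ℂ (StarSubalgebra.centralizer ℂ S : Set (E →L[ℂ] E)) :
        StarSubalgebra ℂ (E →L[ℂ] E)) : Set (E →L[ℂ] E))) =
      ((StarSubalgebra.centralizer ℂ (StarSubalgebra.centralizer ℂ S : Set (E →L[ℂ] E)) :
        StarSubalgebra ℂ (E →L[ℂ] E)) : Set (E →L[ℂ] E))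
    rw [StarSubalgebra.coe_centralizer_centralizer, Set.centralizer_centralizer_centralizer]

variable (E F) in
/-- The Hilbert space tensor product: the completion of the algebraic tensor product for the
inner product `⟪a ⊗ b, c ⊗ d⟫ = ⟪a, c⟫ ⟪b, d⟫`. -/
abbrev HilbertTensor : Type _ := UniformSpace.Completion (E ⊗[ℂ] F)

/-- The bounded operator `a ⊗ b` on the Hilbert space tensor product. -/
def opTensor (a : E →L[ℂ] E) (b : F →L[ℂ] F) : HilbertTensor E F →L[ℂ] HilbertTensor E F :=
  (TensorProduct.mapL a b).completion

@[simp] lemma opTensor_coe (a : E →L[ℂ] E) (b : F →L[ℂ] F) (x : E ⊗[ℂ] F) :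
    opTensor a b (x : HilbertTensor E F) = ((TensorProduct.mapL a b x : E ⊗[ℂ] F) :
      HilbertTensor E F) :=
  ContinuousLinearMap.completion_apply_coe _ _

lemma opTensor_mul (a a' : E →L[ℂ] E) (b b' : F →L[ℂ] F) :
    opTensor (a * a') (b * b') = opTensor a b * opTensor a' b' := by
  ext x
  induction x using UniformSpace.Completion.induction_on with
  | hp => exact isClosed_eq (by fun_prop) (by fun_prop)
  | ih x =>
    rw [mul_apply_eq_comp, opTensor_coe, opTensor_coe, opTensor_coe,
      TensorProduct.mapL_mul, mul_apply_eq_comp]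

lemma opTensor_one : opTensor (1 : E →L[ℂ] E) (1 : F →L[ℂ] F) = 1 := by
  ext x
  induction x using UniformSpace.Completion.induction_on with
  | hp => exact isClosed_eq (by fun_prop) (by fun_prop)
  | ih x =>
    rw [opTensor_coe, show TensorProduct.mapL (1 : E →L[ℂ] E) (1 : F →L[ℂ] F) = 1 from
      TensorProduct.mapL_id_id]
    rfl

lemma inner_mapL [CompleteSpace E] [CompleteSpace F] (a : E →L[ℂ] E) (b : F →L[ℂ] F)
    (x y : E ⊗[ℂ] F) :
    ⟪TensorProduct.mapL (star a) (star b) x, y⟫_ℂ = ⟪x, TensorProduct.mapL a b y⟫_ℂ := by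
  induction x using TensorProduct.induction_on with
  | zero => simp
  | add x x' hx hx' => rw [map_add, inner_add_left, inner_add_left, hx, hx']
  | tmul e f =>
    induction y using TensorProduct.induction_on with
    | zero => simp
    | add y y' hy hy' => rw [map_add, inner_add_right, inner_add_right, hy, hy']
    | tmul e' f' =>
      simp [ContinuousLinearMap.star_eq_adjoint,
        ContinuousLinearMap.adjoint_inner_left]

lemma star_opTensor [CompleteSpace E] [CompleteSpace F] (a : E →L[ℂ] E) (b : F →L[ℂ] F) :
    star (opTensor a b) = opTensor (star a) (star b) := by
  symm
  rw [ContinuousLinearMap.star_eq_adjoint (opTensor a b), ContinuousLinearMap.eq_adjoint_iff]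
  intro x y
  induction x, y using UniformSpace.Completion.induction_on₂ with
  | hp => exact isClosed_eq (by fun_prop) (by fun_prop)
  | ih x y =>
    rw [opTensor_coe, opTensor_coe, UniformSpace.Completion.inner_coe,
      UniformSpace.Completion.inner_coe, inner_mapL]

/-- The tensor product of two unitary operators. -/
def unitaryTensor [CompleteSpace E] [CompleteSpace F] :
    unitary (E →L[ℂ] E) × unitary (F →L[ℂ] F) →*
      unitary (HilbertTensor E F →L[ℂ] HilbertTensor E F) where
  toFun w := ⟨opTensor (w.1 : E →L[ℂ] E) (w.2 : F →L[ℂ] F), by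
    rw [Unitary.mem_iff, star_opTensor, ← opTensor_mul, ← opTensor_mul]
    simp [opTensor_one]⟩
  map_one' := Subtype.ext opTensor_one
  map_mul' _ _ := Subtype.ext (opTensor_mul _ _ _ _)

/-- The von Neumann tensor product of (the von Neumann algebras) `S` on `E` and `T` on `F`: the
von Neumann algebra on the Hilbert space tensor product generated by all `a ⊗ 1`, `a ∈ S`, and all
`1 ⊗ b`, `b ∈ T`. -/
def vnTensor [CompleteSpace E] [CompleteSpace F] (S : Set (E →L[ℂ] E)) (T : Set (F →L[ℂ] F)) :
    VonNeumannAlgebra (HilbertTensor E F) :=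
  generated ((fun a => opTensor a 1) '' S ∪ (fun b => opTensor 1 b) '' T)

end Tensor

/-! ### Trace-preserving `G`-von Neumann algebras -/

/-- A trace-preserving `G`-von Neumann algebra: a von Neumann algebra on a Hilbert space `H`
with a faithful normal tracial state `tr` and an action of the group `G` by `*`-automorphisms which
preserve `tr`. (No continuity of the action is required.) -/
structure TracialGAlgebra (G : Type*) [Group G] (H : Type*) [NormedAddCommGroup H]
    [InnerProductSpace ℂ H] [CompleteSpace H] where
  /-- the underlying von Neumann algebra -/
  alg : VonNeumannAlgebra H
  /-- the trace -/
  tr : alg.toStarSubalgebra →ₗ[ℂ] ℂ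
  tr_one : tr 1 = 1
  tr_mul_comm : ∀ x y, tr (x * y) = tr (y * x)
  tr_faithful : ∀ x, tr (star x * x) = 0 → x = 0
  /-- The trace is a normal positive functional, i.e. a countable sum of vector functionals
  `x ↦ ⟪ξ, x ξ⟫`. -/
  tr_normal : ∃ ξ : ℕ → H, ∀ x : alg.toStarSubalgebra,
    HasSum (fun n => ⟪ξ n, (x : H →L[ℂ] H) (ξ n)⟫_ℂ) (tr x)
  /-- the action of `G` -/
  act : G →* (alg.toStarSubalgebra ≃⋆ₐ[ℂ] alg.toStarSubalgebra)
  tr_act : ∀ g x, tr (act g x) = tr x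

namespace TracialGAlgebra

variable {G : Type*} [Group G] {H : Type*} [NormedAddCommGroup H] [InnerProductSpace ℂ H]
  [CompleteSpace H] (M : TracialGAlgebra G H)

/-- The elements of the von Neumann algebra. -/
abbrev Elem : Type _ := M.alg.toStarSubalgebra

/-- The algebra is abelian. -/
def IsAbelian : Prop := ∀ x y : M.Elem, x * y = y * x

/-- The action is ergodic: the only fixed elements are the scalars. -/
def IsErgodic : Prop := ∀ x : M.Elem, (∀ g, M.act g x = x) → ∃ c : ℂ, x = c • 1

/-- A von Neumann subalgebra (with the same unit) is `G`-invariant. -/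
def IsInvariantSubalgebra (A : VonNeumannAlgebra H) : Prop :=
  A ≤ M.alg ∧ ∀ g (x : M.Elem), (x : H →L[ℂ] H) ∈ A → (M.act g x : H →L[ℂ] H) ∈ A

lemma hasSum_tr_star_mul : ∃ ξ : ℕ → H, ∀ x y : M.Elem,
    HasSum (fun n => ⟪(x : H →L[ℂ] H) (ξ n), (y : H →L[ℂ] H) (ξ n)⟫_ℂ) (M.tr (star x * y)) := by
  obtain ⟨ξ, h⟩ := M.tr_normal
  refine ⟨ξ, fun x y => ?_⟩
  convert h (star x * y) using 2 with n
  simp [ContinuousLinearMap.star_eq_adjoint, ContinuousLinearMap.adjoint_inner_right]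

/-- The algebra itself, regarded as the dense subspace of `L²(M, tr)`. -/
def PreL2 : Type _ := M.Elem

instance : AddCommGroup M.PreL2 := inferInstanceAs (AddCommGroup M.Elem)
instance : Module ℂ M.PreL2 := inferInstanceAs (Module ℂ M.Elem)

/-- The inclusion of the algebra in `L²`, before completion. -/
def toPreL2 : M.Elem ≃ₗ[ℂ] M.PreL2 := LinearEquiv.refl ℂ _

/-- The inner product `⟪x, y⟫ = tr (x* y)`. -/
abbrev preL2Core : InnerProductSpace.Core ℂ M.PreL2 where
  inner x y := M.tr (star (M.toPreL2.symm x) * M.toPreL2.symm y)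
  conj_inner_symm x y := by
    obtain ⟨ξ, h⟩ := M.hasSum_tr_star_mul
    refine ((h (M.toPreL2.symm y) (M.toPreL2.symm x)).map (starRingEnd ℂ)
      Complex.continuous_conj).unique ?_
    convert h (M.toPreL2.symm x) (M.toPreL2.symm y) using 2 with n
    simp
  re_inner_nonneg x := by
    obtain ⟨ξ, h⟩ := M.hasSum_tr_star_mul
    refine ((h (M.toPreL2.symm x) (M.toPreL2.symm x)).map Complex.reCLM
      Complex.reCLM.continuous).nonneg fun n => ?_
    exact inner_self_nonneg (𝕜 := ℂ)
  add_left x y z := by rw [map_add, star_add, add_mul, map_add]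
  smul_left x y r := by simp
  definite x hx := M.toPreL2.symm.map_eq_zero_iff.mp (M.tr_faithful _ hx)

instance : NormedAddCommGroup M.PreL2 :=
  InnerProductSpace.Core.toNormedAddCommGroup (cd := M.preL2Core)
instance : InnerProductSpace ℂ M.PreL2 := InnerProductSpace.ofCore M.preL2Core.toCore

lemma preL2_inner (x y : M.Elem) :
    ⟪M.toPreL2 x, M.toPreL2 y⟫_ℂ = M.tr (star x * y) := rfl

/-- The Hilbert space `L²(M, tr)`, the completion of `M` for `⟪x, y⟫ = tr (x* y)`. -/
abbrev L2 : Type _ := UniformSpace.Completion M.PreL2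

lemma norm_mul_le (a x : M.Elem) :
    ‖M.toPreL2 (a * x)‖ ≤ ‖(a : H →L[ℂ] H)‖ * ‖M.toPreL2 x‖ := by
  rw [← sq_le_sq₀ (norm_nonneg _) (by positivity), mul_pow,
    ← inner_self_eq_norm_sq (𝕜 := ℂ) (M.toPreL2 (a * x)),
    ← inner_self_eq_norm_sq (𝕜 := ℂ) (M.toPreL2 x), preL2_inner, preL2_inner]
  obtain ⟨ξ, h⟩ := M.hasSum_tr_star_mul
  refine hasSum_le (fun n => ?_) ((h (a * x) (a * x)).map Complex.reCLM Complex.reCLM.continuous)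
    (((h x x).map Complex.reCLM Complex.reCLM.continuous).mul_left (‖(a : H →L[ℂ] H)‖ ^ 2))
  have h1 := inner_self_eq_norm_sq (𝕜 := ℂ) (((a * x : M.Elem) : H →L[ℂ] H) (ξ n))
  have h2 := inner_self_eq_norm_sq (𝕜 := ℂ) ((x : H →L[ℂ] H) (ξ n))
  simp only [RCLike.re_to_complex] at h1 h2
  simp only [Function.comp_apply, Complex.reCLM_apply]
  rw [h1, h2, ← mul_pow]
  exact pow_le_pow_left₀ (norm_nonneg _) ((a : H →L[ℂ] H).le_opNorm _) 2

/-- The standard representation of `M` on `L²(M, tr)` by left multiplication. -/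
def leftMul (a : M.Elem) : M.L2 →L[ℂ] M.L2 :=
  ((M.toPreL2.toLinearMap ∘ₗ LinearMap.mulLeft ℂ a ∘ₗ M.toPreL2.symm.toLinearMap).mkContinuous
    ‖(a : H →L[ℂ] H)‖ fun x => M.norm_mul_le a (M.toPreL2.symm x)).completion

@[simp] lemma leftMul_coe (a x : M.Elem) :
    M.leftMul a (M.toPreL2 x : M.L2) = (M.toPreL2 (a * x) : M.L2) :=
  ContinuousLinearMap.completion_apply_coe _ _

lemma norm_act (g : G) (x : M.Elem) : ‖M.toPreL2 (M.act g x)‖ = ‖M.toPreL2 x‖ := by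
  rw [← sq_eq_sq₀ (norm_nonneg _) (norm_nonneg _), ← inner_self_eq_norm_sq (𝕜 := ℂ),
    ← inner_self_eq_norm_sq (𝕜 := ℂ), preL2_inner, preL2_inner, ← map_star, ← map_mul, M.tr_act]

/-- The operator on `L²(M, tr)` which extends the automorphism `act g` of `M`. -/
def koopmanOp (g : G) : M.L2 →L[ℂ] M.L2 :=
  ((M.toPreL2.toLinearMap ∘ₗ (M.act g).toAlgEquiv.toLinearMap ∘ₗ
    M.toPreL2.symm.toLinearMap).mkContinuous 1 fun x => by
      rw [one_mul]; exact (M.norm_act g (M.toPreL2.symm x)).le).completion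

@[simp] lemma koopmanOp_coe (g : G) (x : M.Elem) :
    M.koopmanOp g (M.toPreL2 x : M.L2) = (M.toPreL2 (M.act g x) : M.L2) :=
  ContinuousLinearMap.completion_apply_coe _ _

lemma koopmanOp_one : M.koopmanOp 1 = 1 := by
  ext x
  induction x using UniformSpace.Completion.induction_on with
  | hp => exact isClosed_eq (by fun_prop) (by fun_prop)
  | ih x => exact (M.koopmanOp_coe 1 (M.toPreL2.symm x)).trans (by simp)

lemma koopmanOp_mul (g h : G) : M.koopmanOp (g * h) = M.koopmanOp g * M.koopmanOp h := by
  ext x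
  induction x using UniformSpace.Completion.induction_on with
  | hp => exact isClosed_eq (by fun_prop) (by fun_prop)
  | ih x =>
    obtain ⟨x, rfl⟩ := M.toPreL2.surjective x
    rw [mul_apply_eq_comp, koopmanOp_coe, koopmanOp_coe, koopmanOp_coe, map_mul]
    rfl

lemma star_koopmanOp (g : G) : star (M.koopmanOp g) = M.koopmanOp g⁻¹ := by
  symm
  rw [ContinuousLinearMap.star_eq_adjoint (M.koopmanOp g), ContinuousLinearMap.eq_adjoint_iff]
  intro x y
  induction x, y using UniformSpace.Completion.induction_on₂ with
  | hp => exact isClosed_eq (by fun_prop) (by fun_prop)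
  | ih x y =>
    obtain ⟨x, rfl⟩ := M.toPreL2.surjective x
    obtain ⟨y, rfl⟩ := M.toPreL2.surjective y
    rw [koopmanOp_coe, koopmanOp_coe, UniformSpace.Completion.inner_coe,
      UniformSpace.Completion.inner_coe, preL2_inner, preL2_inner, ← M.tr_act g, map_mul, map_star,
      ← StarAlgEquiv.mul_apply, ← map_mul, mul_inv_cancel, map_one, StarAlgEquiv.one_apply]

/-- The unitary representation of `G` on `L²(M, tr)` which implements the action. -/
def koopman : G →* unitary (M.L2 →L[ℂ] M.L2) where
  toFun g := ⟨M.koopmanOp g, by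
    rw [Unitary.mem_iff, star_koopmanOp, ← koopmanOp_mul, ← koopmanOp_mul]
    simp [koopmanOp_one]⟩
  map_one' := Subtype.ext M.koopmanOp_one
  map_mul' g h := Subtype.ext (M.koopmanOp_mul g h)

lemma koopmanOp_mul_leftMul_mul (g : G) (a : M.Elem) :
    M.koopmanOp g * M.leftMul a * M.koopmanOp g⁻¹ = M.leftMul (M.act g a) := by
  ext x
  induction x using UniformSpace.Completion.induction_on with
  | hp => exact isClosed_eq (by fun_prop) (by fun_prop)
  | ih x =>
    obtain ⟨x, rfl⟩ := M.toPreL2.surjective x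
    rw [mul_apply_eq_comp, mul_apply_eq_comp, koopmanOp_coe, leftMul_coe,
      koopmanOp_coe, leftMul_coe, map_mul, ← StarAlgEquiv.mul_apply, ← map_mul, mul_inv_cancel,
      map_one, StarAlgEquiv.one_apply]

end TracialGAlgebra

/-! ### The tensor product of two trace-preserving `G`-von Neumann algebras -/

section Product

variable {G : Type*} [Group G]
  {H : Type*} [NormedAddCommGroup H] [InnerProductSpace ℂ H] [CompleteSpace H]
  {K : Type*} [NormedAddCommGroup K] [InnerProductSpace ℂ K] [CompleteSpace K]
  (M : TracialGAlgebra G H) (N : TracialGAlgebra G K)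

/-- The Hilbert space `L²(M) ⊗ L²(N)`, on which `M ⊗̄ N` acts. -/
abbrev ProdL2 : Type _ := HilbertTensor M.L2 N.L2

/-- The element `m ⊗ 1` of `M ⊗̄ N`. -/
def inclLeft (m : M.Elem) : ProdL2 M N →L[ℂ] ProdL2 M N := opTensor (M.leftMul m) 1

/-- The element `1 ⊗ n` of `M ⊗̄ N`. -/
def inclRight (n : N.Elem) : ProdL2 M N →L[ℂ] ProdL2 M N := opTensor 1 (N.leftMul n)

/-- The von Neumann tensor product `M ⊗̄ N`, where `M` and `N` are represented faithfully and
normally by left multiplication on `L²(M)` and `L²(N)`. (Up to isomorphism the von Neumann tensor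
product does not depend on the choice of faithful normal representations.) -/
def prodAlg : VonNeumannAlgebra (ProdL2 M N) :=
  vnTensor (Set.range M.leftMul) (Set.range N.leftMul)

/-- For a von Neumann subalgebra `A` of `N`, the subalgebra `M ⊗̄ A` of `M ⊗̄ N`. -/
def prodSubalg (A : VonNeumannAlgebra K) : VonNeumannAlgebra (ProdL2 M N) :=
  vnTensor (Set.range M.leftMul) (N.leftMul '' {n | (n : K →L[ℂ] K) ∈ A})

/-- The diagonal action of `G`: conjugation by the tensor product of the unitaries which implement
the actions on `M` and `N`. It satisfies `g (m ⊗ n) = g m ⊗ g n`. -/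
def diagAct : G →* ((ProdL2 M N →L[ℂ] ProdL2 M N) ≃⋆ₐ[ℂ] (ProdL2 M N →L[ℂ] ProdL2 M N)) :=
  (Unitary.conjStarAlgAut ℂ _).comp (unitaryTensor.comp (M.koopman.prod N.koopman))

lemma diagAct_apply (g : G) (x : ProdL2 M N →L[ℂ] ProdL2 M N) :
    diagAct M N g x = opTensor (M.koopmanOp g) (N.koopmanOp g) * x *
      opTensor (M.koopmanOp g⁻¹) (N.koopmanOp g⁻¹) := by
  change opTensor (M.koopmanOp g) (N.koopmanOp g) * x *
    star (opTensor (M.koopmanOp g) (N.koopmanOp g)) = _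
  rw [star_opTensor, M.star_koopmanOp, N.star_koopmanOp]

/-- The diagonal action on elementary tensors. -/
lemma diagAct_tmul (g : G) (m : M.Elem) (n : N.Elem) :
    diagAct M N g (opTensor (M.leftMul m) (N.leftMul n)) =
      opTensor (M.leftMul (M.act g m)) (N.leftMul (N.act g n)) := by
  rw [diagAct_apply, ← opTensor_mul, ← opTensor_mul, M.koopmanOp_mul_leftMul_mul,
    N.koopmanOp_mul_leftMul_mul]

/-- `q` is in the centre of `M ⊗̄ N`. -/
def IsCentral (q : ProdL2 M N →L[ℂ] ProdL2 M N) : Prop :=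
  q ∈ prodAlg M N ∧ ∀ x ∈ prodAlg M N, q * x = x * q

/-- The set `q (M ⊗̄ N)`; for central `q` it is a two-sided ideal of `M ⊗̄ N`. -/
def principalIdeal (q : ProdL2 M N →L[ℂ] ProdL2 M N) : Set (ProdL2 M N →L[ℂ] ProdL2 M N) :=
  {y | ∃ x ∈ prodAlg M N, y = q * x}

/-- A subset of `M ⊗̄ N` is `G`-invariant. -/
def IsInvariantSet (I : Set (ProdL2 M N →L[ℂ] ProdL2 M N)) : Prop :=
  ∀ g, ∀ x ∈ I, diagAct M N g x ∈ I

/-- The set `M ⊗ 1 + I`. -/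
def intermediate (I : Set (ProdL2 M N →L[ℂ] ProdL2 M N)) :
    Set (ProdL2 M N →L[ℂ] ProdL2 M N) :=
  {y | ∃ m : M.Elem, ∃ x ∈ I, y = inclLeft M N m + x}

/-- A set `V` with `M ⊗ 1 ⊆ V ⊆ M ⊗̄ N` splits if it is `M ⊗̄ A` for some `G`-invariant
von Neumann subalgebra `A` of `N`. -/
def Splits (V : Set (ProdL2 M N →L[ℂ] ProdL2 M N)) : Prop :=
  ∃ A : VonNeumannAlgebra K, N.IsInvariantSubalgebra A ∧ V = prodSubalg M N A

end Product

end ErgodicVNA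

end

/-!
# `M + q (M ⊗̄ N)` does not split for abelian `M` and noncommutative ergodic `N`

Write `P = M ⊗̄ N` and suppose `M + qP = M ⊗̄ A` with `A` an invariant subalgebra of `N`.

The key fact (`eq_zero_of_inclRight_commutators`) is that for a noncommutative invariant `A ⊆ N` the
operators `1 ⊗ [a, b]`, `a, b ∈ A`, have no common kernel: in the original representation of `N` the
projection onto the common kernel of the commutators belongs to `A` and is fixed by `G`, so it is
`0` by ergodicity; slicing and the normality of the trace carry this over to `L²(M) ⊗ L²(N)`.

If `A` is commutative, so are `M ⊗̄ A` and its subset `qP`; hence `q² (1 ⊗ [a, b]) = 0` for all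
`a, b ∈ N` and `q = 0` by the key fact for `N`.

If `A` is not commutative, then, since `M` is abelian, all commutators of `M + qP` are multiples of
`q`. By the key fact `q` is injective, which forces `M ⊗̄ A = P`. Now `P = M + qP`, and the open
mapping theorem gives a constant `C` such that `[a, b] = q w` with `‖w‖ ≤ C ‖a‖ ‖b‖` for all
`a, b ∈ P` (`exists_bound_commutator`). On a `P`-invariant subspace where `|q| ≤ δ < 1 / C` this
smallness of commutators is self-improving, so all commutators vanish there
(`commutator_apply_eq_zero`). By the key fact such a subspace is zero. Thus `q* q ≥ δ²`, the
operator `q` is invertible in `P`, and `qP = P`, contrary to assumption.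
-/

/-! ### Von Neumann algebras and their commutators -/

section Abstract

variable {E : Type*} [NormedAddCommGroup E] [InnerProductSpace ℂ E] [CompleteSpace E]

namespace VonNeumannAlgebra

lemma isClosed_coe (P : VonNeumannAlgebra E) : IsClosed (P : Set (E →L[ℂ] E)) := by
  rw [← P.centralizer_centralizer]
  exact Set.isClosed_centralizer _

instance (P : VonNeumannAlgebra E) : IsClosed (P.toStarSubalgebra : Set (E →L[ℂ] E)) :=
  P.isClosed_coe

lemma mem_of_forall_commute {P : VonNeumannAlgebra E} {x : E →L[ℂ] E}
    (h : ∀ y ∈ P.commutant, y * x = x * y) : x ∈ P := by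
  rw [← P.commutant_commutant]
  exact mem_commutant_iff.2 h

end VonNeumannAlgebra

namespace ErgodicVNA

lemma subset_generated (S : Set (E →L[ℂ] E)) : S ⊆ generated S := by
  intro x hx
  change x ∈ StarSubalgebra.centralizer ℂ _
  rw [StarSubalgebra.mem_centralizer_iff]
  intro y hy
  have h2 := (StarSubalgebra.mem_centralizer_iff ℂ).1 hy
  have h3 := (StarSubalgebra.mem_centralizer_iff ℂ).1 (star_mem hy)
  exact ⟨((h2 x hx).1).symm, ((h3 x hx).1).symm⟩

/-- Operators commuting with `S` and `S*` commute with the algebra generated by `S`. -/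
lemma commute_of_mem_generated {S : Set (E →L[ℂ] E)} {y : E →L[ℂ] E}
    (h : ∀ s ∈ S, s * y = y * s ∧ star s * y = y * star s) {x : E →L[ℂ] E}
    (hx : x ∈ generated S) : y * x = x * y :=
  ((StarSubalgebra.mem_centralizer_iff ℂ).1 (show x ∈ StarSubalgebra.centralizer ℂ _ from hx) y
    ((StarSubalgebra.mem_centralizer_iff ℂ).2 h)).1

lemma generated_le {S : Set (E →L[ℂ] E)} {P : VonNeumannAlgebra E}
    (h : S ⊆ P) : generated S ≤ P := by
  intro x hx
  refine VonNeumannAlgebra.mem_of_forall_commute fun y hy => commute_of_mem_generated ?_ hx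
  intro s hs
  rw [VonNeumannAlgebra.mem_commutant_iff] at hy
  exact ⟨hy s (h hs), hy _ (star_mem (h hs))⟩

lemma generated_comm {S : Set (E →L[ℂ] E)} (hstar : ∀ s ∈ S, star s ∈ S)
    (hcomm : ∀ s ∈ S, ∀ t ∈ S, s * t = t * s) {x y : E →L[ℂ] E}
    (hx : x ∈ generated S) (hy : y ∈ generated S) : x * y = y * x := by
  refine commute_of_mem_generated (fun s hs => ?_) hy
  have key : ∀ s ∈ S, s * x = x * s := fun s hs =>
    commute_of_mem_generated (fun t ht => ⟨hcomm t ht s hs, hcomm _ (hstar t ht) s hs⟩) hx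
  exact ⟨key s hs, key _ (hstar s hs)⟩

lemma eq_zero_of_mul_self_eq_zero {x : E →L[ℂ] E} (hx : star x * x = x * star x)
    (h : x * x = 0) : x = 0 := by
  have h1 : star (star x * x) * (star x * x) = 0 := by
    rw [star_mul, star_star]
    nth_rw 2 [hx]
    rw [mul_assoc, ← mul_assoc x x, h, zero_mul, mul_zero]
  exact (CStarRing.star_mul_self_eq_zero_iff _).1 ((CStarRing.star_mul_self_eq_zero_iff _).1 h1)

lemma commutator_add_mul {R : Type*} [Ring R] {q m n x y : R} (hm : Commute q m) (hn : Commute q n)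
    (hx : Commute q x) (hy : Commute q y) (hmn : Commute m n) :
    (m + q * x) * (n + q * y) - (n + q * y) * (m + q * x) =
      q * ((m * y - y * m) + (x * n - n * x) + q * (x * y - y * x)) := by
  simp only [mul_add, add_mul, mul_sub, mul_assoc, hm.symm.left_comm, hn.symm.left_comm,
    hx.symm.left_comm, hy.symm.left_comm, hmn.eq]
  abel

/-- If `P = A + qP` with `A` commutative and `q` central, then commutators in `P` are divisible by
`q`, with a bound on the quotient that comes from the open mapping theorem. -/
lemma exists_bound_commutator {P A : VonNeumannAlgebra E} {q : E →L[ℂ] E}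
    (hq : q ∈ P) (hqc : ∀ x ∈ P, q * x = x * q) (hAP : A ≤ P)
    (hA : ∀ x ∈ A, ∀ y ∈ A, x * y = y * x)
    (hP : ∀ x ∈ P, ∃ m ∈ A, ∃ y ∈ P, x = m + q * y) :
    ∃ C : ℝ, 0 ≤ C ∧ ∀ a ∈ P, ∀ b ∈ P, ∃ w ∈ P, a * b - b * a = q * w ∧
      ‖w‖ ≤ C * ‖a‖ * ‖b‖ := by
  have : CompleteSpace A.toStarSubalgebra.toSubmodule := A.isClosed_coe.completeSpace_coe
  have : CompleteSpace P.toStarSubalgebra.toSubmodule := P.isClosed_coe.completeSpace_coe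
  let f : A.toStarSubalgebra.toSubmodule × P.toStarSubalgebra.toSubmodule →L[ℂ]
      P.toStarSubalgebra.toSubmodule :=
    (((Submodule.subtypeL _).comp (ContinuousLinearMap.fst ℂ _ _)) +
      (ContinuousLinearMap.mul ℂ (E →L[ℂ] E) q).comp
        ((Submodule.subtypeL _).comp (ContinuousLinearMap.snd ℂ _ _))).codRestrict _
      fun z => add_mem (s := P) (hAP z.1.2) (mul_mem (s := P) hq z.2.2)
  have hf : Function.Surjective f := by
    rintro ⟨x, hx⟩
    obtain ⟨m, hm, y, hy, e⟩ := hP x hx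
    exact ⟨(⟨m, hm⟩, ⟨y, hy⟩), Subtype.ext e.symm⟩
  obtain ⟨D, hD, h⟩ := f.exists_preimage_norm_le hf
  have key : ∀ a ∈ P, ∃ m ∈ A, ∃ y ∈ P, a = m + q * y ∧ ‖m‖ ≤ D * ‖a‖ ∧ ‖y‖ ≤ D * ‖a‖ := by
    intro a ha
    obtain ⟨z, hz, hz'⟩ := h ⟨a, ha⟩
    exact ⟨z.1, z.1.2, z.2, z.2.2, (congrArg Subtype.val hz).symm,
      (norm_fst_le z).trans hz', (norm_snd_le z).trans hz'⟩
  refine ⟨2 * D ^ 2 * (2 + ‖q‖), by positivity, fun a ha b hb => ?_⟩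
  obtain ⟨m, hm, x, hx, ea, hm', hx'⟩ := key a ha
  obtain ⟨n, hn, y, hy, eb, hn', hy'⟩ := key b hb
  refine ⟨(m * y - y * m) + (x * n - n * x) + q * (x * y - y * x), ?_, ?_, ?_⟩
  · have := hAP hm
    have := hAP hn
    exact add_mem (add_mem (sub_mem (mul_mem ‹_› hy) (mul_mem hy ‹_›))
      (sub_mem (mul_mem hx ‹_›) (mul_mem ‹_› hx)))
      (mul_mem hq (sub_mem (mul_mem hx hy) (mul_mem hy hx)))
  · rw [ea, eb]
    exact commutator_add_mul (hqc m (hAP hm)) (hqc n (hAP hn)) (hqc x hx) (hqc y hy)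
      (hA m hm n hn)
  · have hmul : ∀ s t : E →L[ℂ] E, ∀ α β : ℝ, ‖s‖ ≤ α → ‖t‖ ≤ β →
        ‖s * t - t * s‖ ≤ 2 * (α * β) := by
      intro s t α β hs ht
      have h1 : ‖s * t‖ ≤ α * β := (norm_mul_le _ _).trans (by gcongr; exact (norm_nonneg s).trans hs)
      have h2 : ‖t * s‖ ≤ α * β := (norm_mul_le _ _).trans (by
        rw [mul_comm]; gcongr; exact (norm_nonneg s).trans hs)
      linarith [norm_sub_le (s * t) (t * s)]
    have h1 := hmul m y _ _ hm' hy'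
    have h2 := hmul x n _ _ hx' hn'
    have h3 := hmul x y _ _ hx' hy'
    have h4 : ‖q * (x * y - y * x)‖ ≤ ‖q‖ * (2 * (D * ‖a‖ * (D * ‖b‖))) :=
      (norm_mul_le _ _).trans (by gcongr)
    calc _ ≤ ‖m * y - y * m‖ + ‖x * n - n * x‖ + ‖q * (x * y - y * x)‖ := norm_add₃_le
      _ ≤ _ := by nlinarith

/-- If commutators in `P` are divisible by the central element `q` with constant `C`, they vanish
on every `P`-invariant set `L` of vectors on which `q` is smaller than `C⁻¹`. For unitary `u` the
displacement `d u b = u b u* - b` is a multiple of `q`, and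
`2 d u b = d (u ^ 2) b - d u (d u b)`, where the last term picks up another factor `q`; this
improves any bound of `d` on `L` by the factor `(1 + C δ) / 2`. -/
lemma commutator_apply_eq_zero {P : VonNeumannAlgebra E} {q : E →L[ℂ] E}
    (hq : q ∈ P) (hqc : ∀ x ∈ P, q * x = x * q) {C δ : ℝ} (hC : 0 ≤ C) (hδ : 0 ≤ δ)
    (hCδ : C * δ < 1)
    (hw : ∀ a ∈ P, ∀ b ∈ P, ∃ w ∈ P, a * b - b * a = q * w ∧ ‖w‖ ≤ C * ‖a‖ * ‖b‖)
    {L : Set E} (hL : ∀ x ∈ P, ∀ l ∈ L, x l ∈ L) (hqL : ∀ l ∈ L, ‖q l‖ ≤ δ * ‖l‖)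
    {a b : E →L[ℂ] E} (ha : a ∈ P) (hb : b ∈ P) {l : E} (hl : l ∈ L) :
    (a * b - b * a) l = 0 := by
  have hnorm : ∀ u ∈ unitary (E →L[ℂ] E), ‖u‖ ≤ 1 := fun u hu => by
    rw [← mul_one u, CStarRing.norm_mem_unitary_mul _ hu]
    exact ContinuousLinearMap.norm_id_le
  have step : ∀ s : ℝ, 0 ≤ s →
      (∀ u ∈ P, u ∈ unitary (E →L[ℂ] E) → ∀ b ∈ P, ∀ l ∈ L,
        ‖(u * b * star u - b) l‖ ≤ s * ‖b‖ * ‖l‖) →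
      ∀ u ∈ P, u ∈ unitary (E →L[ℂ] E) → ∀ b ∈ P, ∀ l ∈ L,
        ‖(u * b * star u - b) l‖ ≤ ((1 + C * δ) / 2 * s) * ‖b‖ * ‖l‖ := by
    intro s hs h u huP hu b hb l hl
    obtain ⟨w, hwP, hw1, hw2⟩ := hw u huP b hb
    have hx : ‖w * star u‖ ≤ C * ‖b‖ := by
      rw [CStarRing.norm_mul_mem_unitary _ (Unitary.star_mem hu)]
      calc ‖w‖ ≤ C * ‖u‖ * ‖b‖ := hw2
        _ ≤ C * 1 * ‖b‖ := by gcongr; exact hnorm u hu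
        _ = _ := by ring
    have hxP : w * star u ∈ P := mul_mem hwP (star_mem huP)
    have hd : u * b * star u - b = q * (w * star u) := by
      rw [← mul_assoc, ← hw1, sub_mul, mul_assoc b, Unitary.mul_star_self_of_mem hu, mul_one]
    have h2 : (2 : ℂ) • (u * b * star u - b) =
        ((u * u) * b * star (u * u) - b) - (u * (w * star u) * star u - w * star u) * q := by
      have e1 : (u * (w * star u) * star u - w * star u) * q
          = u * (u * b * star u - b) * star u - (u * b * star u - b) := by
        rw [hd, ← hqc _ (sub_mem (mul_mem (mul_mem huP hxP) (star_mem huP)) hxP), mul_sub,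
          ← mul_assoc q (u * _) (star u), ← mul_assoc q u, hqc u huP, mul_assoc u q]
      rw [e1, two_smul, star_mul]
      simp only [mul_sub, sub_mul, mul_assoc]
      abel
    have h3 := h (u * u) (mul_mem huP huP) (mul_mem hu hu) b hb l hl
    have h4 : ‖((u * (w * star u) * star u - w * star u) * q) l‖ ≤ s * (C * ‖b‖) * (δ * ‖l‖) := by
      refine (h u huP hu _ hxP (q l) (hL q hq l hl)).trans ?_
      gcongr
      exact hqL l hl
    have h5 := congrArg (fun T : E →L[ℂ] E => ‖T l‖) h2
    simp only [smul_apply, norm_smul, Complex.norm_ofNat, sub_apply] at h5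
    have h6 := norm_sub_le (((u * u) * b * star (u * u) - b) l)
      (((u * (w * star u) * star u - w * star u) * q) l)
    simp only [sub_apply] at h3 h4 h6 ⊢
    linarith
  have bound : ∀ n : ℕ, ∀ u ∈ P, u ∈ unitary (E →L[ℂ] E) → ∀ b ∈ P, ∀ l ∈ L,
      ‖(u * b * star u - b) l‖ ≤ (((1 + C * δ) / 2) ^ n * 2) * ‖b‖ * ‖l‖ := by
    intro n
    induction n with
    | zero =>
      intro u huP hu b hb l hl
      refine ((_ : E →L[ℂ] E).le_opNorm l).trans ?_
      gcongr
      have := norm_sub_le (u * b * star u) b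
      rw [CStarRing.norm_mul_mem_unitary _ (Unitary.star_mem hu),
        CStarRing.norm_mem_unitary_mul _ hu] at this
      linarith
    | succ n ih =>
      intro u huP hu b hb l hl
      have := step _ (by positivity) ih u huP hu b hb l hl
      rwa [← mul_assoc, ← pow_succ'] at this
  have zero : ∀ u ∈ P, u ∈ unitary (E →L[ℂ] E) → ∀ b ∈ P, ∀ l ∈ L,
      (u * b * star u - b) l = 0 := by
    intro u huP hu b hb l hl
    have ht := ((tendsto_pow_atTop_nhds_zero_of_lt_one (r := (1 + C * δ) / 2)
      (by positivity) (by linarith)).mul_const 2).mul_const ‖b‖ |>.mul_const ‖l‖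
    simp only [zero_mul] at ht
    exact norm_le_zero_iff.1 (ge_of_tendsto' ht fun n => bound n u huP hu b hb l hl)
  have main : ∀ a : P.toStarSubalgebra, ((a : E →L[ℂ] E) * b - b * (a : E →L[ℂ] E)) l = 0 := by
    intro a
    have ha : a ∈ Submodule.span ℂ (unitary P.toStarSubalgebra : Set P.toStarSubalgebra) := by
      rw [CStarAlgebra.span_unitary]; trivial
    induction ha using Submodule.span_induction with
    | mem u hu =>
      have hu' : (u : E →L[ℂ] E) ∈ unitary (E →L[ℂ] E) :=
        ⟨congrArg Subtype.val (Unitary.star_mul_self_of_mem hu),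
          congrArg Subtype.val (Unitary.mul_star_self_of_mem hu)⟩
      have h2 : ((u : E →L[ℂ] E) * b * star (u : E →L[ℂ] E) - b) * (u : E →L[ℂ] E) =
          (u : E →L[ℂ] E) * b - b * (u : E →L[ℂ] E) := by
        rw [sub_mul, mul_assoc _ (star _), Unitary.star_mul_self_of_mem hu', mul_one]
      rw [← h2]
      exact zero u u.2 hu' b hb _ (hL _ u.2 l hl)
    | zero => simp
    | add x y _ _ hx hy =>
      simp only [sub_apply, add_mul, mul_add, AddMemClass.coe_add, add_apply] at hx hy ⊢
      rw [add_sub_add_comm, hx, hy, add_zero]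
    | smul c x _ hx =>
      have e : ((c • x : P.toStarSubalgebra) : E →L[ℂ] E) = c • (x : E →L[ℂ] E) := rfl
      rw [e, smul_mul_assoc, mul_smul_comm, ← smul_sub, smul_apply, hx, smul_zero]
  exact main ⟨a, ha⟩

/-- If commutators in `P` are `q`-divisible with a bound and have no common kernel vector, then
`q` is invertible in `P`. -/
lemma exists_mul_eq_one {P : VonNeumannAlgebra E} {q : E →L[ℂ] E}
    (hq : q ∈ P) (hqc : ∀ x ∈ P, q * x = x * q) {C : ℝ} (hC : 0 ≤ C)
    (hw : ∀ a ∈ P, ∀ b ∈ P, ∃ w ∈ P, a * b - b * a = q * w ∧ ‖w‖ ≤ C * ‖a‖ * ‖b‖)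
    (hker : ∀ v : E, (∀ a ∈ P, ∀ b ∈ P, (a * b - b * a) v = 0) → v = 0) :
    ∃ r ∈ P, q * r = 1 := by
  obtain ⟨δ, hδ, hCδ⟩ : ∃ δ : ℝ, 0 < δ ∧ C * δ < 1 :=
    ⟨(C + 1)⁻¹, by positivity, by
      rw [← div_eq_mul_inv, div_lt_one (by positivity)]; linarith⟩
  have hnorm : star q * q = q * star q := (hqc _ (star_mem hq)).symm
  set k : E →L[ℂ] E := algebraMap ℝ _ (δ ^ 2) - star q * q with hk
  have hksa : IsSelfAdjoint k :=
    (IsSelfAdjoint.algebraMap _ (IsSelfAdjoint.all _)).sub (IsSelfAdjoint.star_mul_self q)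
  have hqs : ∀ x ∈ P, star q * x = x * star q := by
    intro x hx
    simpa using (congrArg star (hqc _ (star_mem hx))).symm
  have hkc : ∀ x ∈ P, Commute (k⁻) x := by
    intro x hx
    refine Commute.cfcₙ_real ?_ _
    refine Commute.sub_left (Algebra.commutes (δ ^ 2) x) ?_
    exact (show Commute (star q) x from hqs x hx).mul_left (hqc x hx)
  have hzero : ∀ l : E, k⁻ l = 0 → l = 0 := by
    intro l hl
    refine hker l fun a ha b hb => ?_
    -- on the kernel of the negative part of `δ² - q* q` one has `‖q l‖ ≤ δ ‖l‖`
    refine commutator_apply_eq_zero (L := {l | k⁻ l = 0}) hq hqc hC hδ.le hCδ hw ?_ ?_ ha hb hl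
    · intro x hx l hl
      change (k⁻ * x) l = 0
      rw [(hkc x hx).eq, mul_apply_eq_comp, show k⁻ l = 0 from hl, map_zero]
    · intro l hl
      have h1 : 0 ≤ RCLike.re ⟪k⁺ l, l⟫_ℂ :=
        ((ContinuousLinearMap.nonneg_iff_isPositive _).1
          (CFC.posPart_nonneg k)).re_inner_nonneg_left l
      have h2 : k⁺ l = k l := by
        conv_rhs => rw [← CFC.posPart_sub_negPart k hksa]
        rw [sub_apply, show k⁻ l = 0 from hl, sub_zero]
      have h3 : k l = ((δ ^ 2 : ℝ) : ℂ) • l - (star q) (q l) := by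
        rw [hk, sub_apply, mul_apply_eq_comp, Algebra.algebraMap_eq_smul_one]
        rfl
      rw [h2, h3, inner_sub_left, inner_smul_left, ContinuousLinearMap.star_eq_adjoint,
        ContinuousLinearMap.adjoint_inner_left, inner_self_eq_norm_sq_to_K,
        inner_self_eq_norm_sq_to_K] at h1
      have h4 : 0 ≤ δ ^ 2 * ‖l‖ ^ 2 - ‖q l‖ ^ 2 := by
        have e : (starRingEnd ℂ) ((δ ^ 2 : ℝ) : ℂ) * ((‖l‖ : ℂ)) ^ 2 - ((‖q l‖ : ℂ)) ^ 2
          = ((δ ^ 2 * ‖l‖ ^ 2 - ‖q l‖ ^ 2 : ℝ) : ℂ) := by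
          rw [Complex.conj_ofReal]; push_cast; ring
        have h1' : 0 ≤ ((starRingEnd ℂ) ((δ ^ 2 : ℝ) : ℂ) * ((‖l‖ : ℂ)) ^ 2
          - ((‖q l‖ : ℂ)) ^ 2).re := h1
        rwa [e, Complex.ofReal_re] at h1'
      refine abs_le_of_sq_le_sq' ?_ (by positivity) |>.2
      rw [mul_pow]; linarith
  have hpos : k⁺ = 0 := by
    ext v
    refine hzero _ ?_
    rw [← mul_apply_eq_comp, CFC.negPart_mul_posPart, zero_apply]
  have hle : algebraMap ℝ (E →L[ℂ] E) (δ ^ 2) ≤ star q * q := by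
    rw [← sub_nonpos]
    exact (CFC.posPart_eq_zero_iff k hksa).1 hpos
  have hu : IsUnit (star q * q) :=
    CStarAlgebra.isUnit_of_le _ hle
      (isStrictlyPositive_algebraMap (by positivity))
  obtain ⟨s, hs⟩ := hu
  refine ⟨star q * (↑s⁻¹ : E →L[ℂ] E), ?_, ?_⟩
  · refine mul_mem (star_mem hq) (VonNeumannAlgebra.mem_of_forall_commute fun y hy => ?_)
    rw [VonNeumannAlgebra.mem_commutant_iff] at hy
    have : Commute y (s : E →L[ℂ] E) := by
      rw [hs]; exact (hy _ (mul_mem (star_mem hq) hq)).symm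
    exact this.units_inv_right
  · rw [← mul_assoc, ← hnorm, ← hs, Units.mul_inv]

end ErgodicVNA

end Abstract

noncomputable section

namespace ErgodicVNA

/-! ### The standard representation and ergodic algebras -/

namespace TracialGAlgebra

variable {G : Type*} [Group G] {H : Type*} [NormedAddCommGroup H] [InnerProductSpace ℂ H]
  [CompleteSpace H] (M : TracialGAlgebra G H)

lemma leftMul_mul (a b : M.Elem) : M.leftMul (a * b) = M.leftMul a * M.leftMul b := by
  ext x
  induction x using UniformSpace.Completion.induction_on with
  | hp => exact isClosed_eq (by fun_prop) (by fun_prop)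
  | ih x =>
    obtain ⟨x, rfl⟩ := M.toPreL2.surjective x
    rw [mul_apply_eq_comp, leftMul_coe, leftMul_coe, leftMul_coe, mul_assoc]

lemma leftMul_sub (a b : M.Elem) : M.leftMul (a - b) = M.leftMul a - M.leftMul b := by
  ext x
  induction x using UniformSpace.Completion.induction_on with
  | hp => exact isClosed_eq (by fun_prop) (by fun_prop)
  | ih x =>
    obtain ⟨x, rfl⟩ := M.toPreL2.surjective x
    rw [sub_apply, leftMul_coe, leftMul_coe, leftMul_coe, sub_mul, map_sub,
      UniformSpace.Completion.coe_sub]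

lemma star_leftMul (a : M.Elem) : star (M.leftMul a) = M.leftMul (star a) := by
  symm
  rw [ContinuousLinearMap.star_eq_adjoint (M.leftMul a), ContinuousLinearMap.eq_adjoint_iff]
  intro x y
  induction x, y using UniformSpace.Completion.induction_on₂ with
  | hp => exact isClosed_eq (by fun_prop) (by fun_prop)
  | ih x y =>
    obtain ⟨x, rfl⟩ := M.toPreL2.surjective x
    obtain ⟨y, rfl⟩ := M.toPreL2.surjective y
    rw [leftMul_coe, leftMul_coe, UniformSpace.Completion.inner_coe,
      UniformSpace.Completion.inner_coe, preL2_inner, preL2_inner, star_mul, star_star, mul_assoc]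

/-- `L²(M, tr)` embeds isometrically in a countable multiple of the original Hilbert space `H`,
compatibly with the actions of `M`. This expresses that the standard representation is normal. -/
lemma exists_isometry_lp : ∃ V : M.L2 → lp (fun _ : ℕ => H) 2,
    (∀ x, ‖V x‖ = ‖x‖) ∧ ∀ (a : M.Elem) x n, V (M.leftMul a x) n = (a : H →L[ℂ] H) (V x n) := by
  obtain ⟨ξ, h⟩ := M.hasSum_tr_star_mul
  have hs : ∀ x : M.Elem, HasSum (fun n => ‖(x : H →L[ℂ] H) (ξ n)‖ ^ 2) (‖M.toPreL2 x‖ ^ 2) := by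
    intro x
    rw [← inner_self_eq_norm_sq (𝕜 := ℂ), preL2_inner]
    convert (h x x).map Complex.reCLM Complex.reCLM.continuous using 2 with n
    · exact (inner_self_eq_norm_sq (𝕜 := ℂ) _).symm
    · rfl
  have hmem : ∀ x : M.Elem, Memℓp (fun n => (x : H →L[ℂ] H) (ξ n)) 2 := by
    intro x
    refine memℓp_gen ?_
    simpa using (hs x).summable
  let V₀ : M.PreL2 →ₗᵢ[ℂ] lp (fun _ : ℕ => H) 2 :=
    { toFun := fun x => ⟨_, hmem (M.toPreL2.symm x)⟩
      map_add' := fun x y => by ext n; simp; rfl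
      map_smul' := fun c x => by ext n; simp
      norm_map' := fun x => by
        rw [← sq_eq_sq₀ (norm_nonneg _) (norm_nonneg _)]
        have h1 := lp.norm_rpow_eq_tsum (p := 2) (by norm_num)
          (⟨_, hmem (M.toPreL2.symm x)⟩ : lp (fun _ : ℕ => H) 2)
        have h2 := (hs (M.toPreL2.symm x)).tsum_eq
        simp only [ENNReal.toReal_ofNat, Real.rpow_ofNat] at h1
        exact h1.trans h2 }
  have hV₀ : ∀ (x : M.Elem) n, V₀ (M.toPreL2 x) n = (x : H →L[ℂ] H) (ξ n) := fun _ _ => rfl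
  refine ⟨UniformSpace.Completion.extension V₀, fun x => ?_, fun a x n => ?_⟩
  · induction x using UniformSpace.Completion.induction_on with
    | hp =>
      exact isClosed_eq (UniformSpace.Completion.continuous_extension.norm) (by fun_prop)
    | ih x =>
      rw [UniformSpace.Completion.extension_coe V₀.isometry.uniformContinuous, V₀.norm_map,
        UniformSpace.Completion.norm_coe]
  · have hc : Continuous fun f : lp (fun _ : ℕ => H) 2 => f n :=
      (continuous_apply n).comp (lp.uniformContinuous_coe).continuous
    induction x using UniformSpace.Completion.induction_on with
    | hp =>
      exact isClosed_eq (hc.comp (UniformSpace.Completion.continuous_extension.comp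
        (M.leftMul a).continuous)) ((a : H →L[ℂ] H).continuous.comp
          (hc.comp UniformSpace.Completion.continuous_extension))
    | ih x =>
      obtain ⟨x, rfl⟩ := M.toPreL2.surjective x
      rw [leftMul_coe, UniformSpace.Completion.extension_coe V₀.isometry.uniformContinuous,
        UniformSpace.Completion.extension_coe V₀.isometry.uniformContinuous, hV₀, hV₀]
      rfl

/-- The common kernel of the commutators of a noncommutative invariant subalgebra of an ergodic
algebra is trivial: the projection onto it lies in the subalgebra and is fixed by `G`, hence
is a scalar. -/
lemma eq_zero_of_commutators_apply_eq_zero (hM : M.IsErgodic) {A : VonNeumannAlgebra H}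
    (hA : M.IsInvariantSubalgebra A) (hnc : ∃ a ∈ A, ∃ b ∈ A, a * b ≠ b * a) {η : H}
    (hη : ∀ a ∈ A, ∀ b ∈ A, (a * b - b * a) η = 0) : η = 0 := by
  let L : Submodule ℂ H := ⨅ a : A, ⨅ b : A, ((a * b - b * a : H →L[ℂ] H)).ker
  have hL : ∀ ζ, ζ ∈ L ↔ ∀ a ∈ A, ∀ b ∈ A, (a * b - b * a) ζ = 0 := by
    intro ζ
    simp [L, Submodule.mem_iInf]
  have hLc : IsClosed (L : Set H) := by
    have : (L : Set H) = ⋂ a ∈ A, ⋂ b ∈ A, {ζ | (a * b - b * a) ζ = 0} := by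
      ext ζ
      simp only [Set.mem_iInter]
      exact hL ζ
    rw [this]
    exact isClosed_biInter fun a _ => isClosed_biInter fun b _ =>
      isClosed_eq (ContinuousLinearMap.continuous _) continuous_const
  have : CompleteSpace L := hLc.completeSpace_coe
  set p : H →L[ℂ] H := L.starProjection with hp
  have hpmem : ∀ ζ, p ζ ∈ L := fun ζ => L.starProjection_apply_mem ζ
  have hpfix : ∀ ζ ∈ L, p ζ = ζ := fun ζ hζ => L.starProjection_eq_self_iff.2 hζ
  have hpA : p ∈ A := by
    rw [VonNeumannAlgebra.IsStarProjection.mem_iff (isStarProjection_starProjection)]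
    intro y hy
    rw [Submodule.range_starProjection]
    intro ζ hζ
    change y ζ ∈ L
    rw [hL] at hζ ⊢
    intro a ha b hb
    have := VonNeumannAlgebra.mem_commutant_iff.1 hy _ (sub_mem (mul_mem ha hb) (mul_mem hb ha))
    rw [← mul_apply_eq_comp, this, mul_apply_eq_comp, hζ a ha b hb, map_zero]
  let e : M.Elem := ⟨p, hA.1 hpA⟩
  -- `act g` permutes the commutators of `A`, so the range of `act g e` lies in `L` too
  have hcomp : ∀ g, e * M.act g e = M.act g e := by
    intro g
    refine Subtype.ext (ContinuousLinearMap.ext fun ζ => hpfix _ ((hL _).2 fun a ha b hb => ?_))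
    have hk : ∀ a (ha : a ∈ A), ∃ a' : M.Elem, (a' : H →L[ℂ] H) ∈ A ∧
        M.act g a' = ⟨a, hA.1 ha⟩ := fun a ha => by
      refine ⟨M.act g⁻¹ ⟨a, hA.1 ha⟩, hA.2 g⁻¹ _ ha, ?_⟩
      rw [← StarAlgEquiv.mul_apply, ← map_mul, mul_inv_cancel, map_one, StarAlgEquiv.one_apply]
    obtain ⟨a', ha', ea⟩ := hk a ha
    obtain ⟨b', hb', eb⟩ := hk b hb
    have h0 : (a' * b' - b' * a') * e = 0 := by
      refine Subtype.ext (ContinuousLinearMap.ext fun θ => ?_)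
      exact (hL _).1 (hpmem θ) _ ha' _ hb'
    have h1 := congrArg (M.act g) h0
    rw [map_mul, map_sub, map_mul, map_mul, ea, eb, map_zero] at h1
    exact congrArg (fun T : M.Elem => (T : H →L[ℂ] H) ζ) h1
  have hstar : star e = e :=
    Subtype.ext (isStarProjection_starProjection (U := L)).isSelfAdjoint.star_eq
  have hfix : ∀ g, M.act g e = e := by
    intro g
    have h1 := congrArg (M.act g) (hcomp g⁻¹)
    rw [map_mul, ← StarAlgEquiv.mul_apply, ← map_mul, mul_inv_cancel, map_one,
      StarAlgEquiv.one_apply] at h1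
    have h2 := congrArg star (hcomp g)
    rw [star_mul, ← map_star, hstar] at h2
    rw [← h2, h1]
  obtain ⟨c, hc⟩ := hM e hfix
  by_contra hne
  have hpc : ∀ ζ, p ζ = c • ζ := fun ζ =>
    congrArg (fun T : M.Elem => (T : H →L[ℂ] H) ζ) hc
  have hc1 : c = 1 := by
    have h1 := hpfix η ((hL η).2 hη)
    rw [hpc] at h1
    exact smul_left_injective ℂ hne (h1.trans (one_smul ℂ η).symm)
  obtain ⟨a, ha, b, hb, hab⟩ := hnc
  refine hab (sub_eq_zero.1 (ContinuousLinearMap.ext fun ζ => ?_))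
  refine (hL ζ).1 ?_ a ha b hb
  have := hpmem ζ
  rwa [hpc, hc1, one_smul] at this

end TracialGAlgebra

/-! ### Slices and commutators in the tensor product -/

section Product

variable {G : Type*} [Group G]
  {H : Type*} [NormedAddCommGroup H] [InnerProductSpace ℂ H] [CompleteSpace H]
  {K : Type*} [NormedAddCommGroup K] [InnerProductSpace ℂ K] [CompleteSpace K]
  (M : TracialGAlgebra G H) (N : TracialGAlgebra G K)

lemma opTensor_one_sub {E F : Type*} [NormedAddCommGroup E] [InnerProductSpace ℂ E]
    [NormedAddCommGroup F] [InnerProductSpace ℂ F] (b b' : F →L[ℂ] F) :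
    opTensor (1 : E →L[ℂ] E) (b - b') = opTensor 1 b - opTensor 1 b' := by
  ext x
  induction x using UniformSpace.Completion.induction_on with
  | hp => exact isClosed_eq (by fun_prop) (by fun_prop)
  | ih x =>
    rw [sub_apply, opTensor_coe, opTensor_coe, opTensor_coe, ← UniformSpace.Completion.coe_sub]
    congr 1
    induction x using TensorProduct.induction_on with
    | zero => rw [map_zero, map_zero, map_zero, sub_zero]
    | add x y hx hy => rw [map_add, map_add, map_add, hx, hy]; abel
    | tmul e f => simp [TensorProduct.tmul_sub]

lemma inclRight_commutator (a b : N.Elem) : inclRight M N (a * b - b * a) =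
    inclRight M N a * inclRight M N b - inclRight M N b * inclRight M N a := by
  simp only [inclRight, N.leftMul_sub, N.leftMul_mul, opTensor_one_sub, ← opTensor_mul, mul_one]

lemma eq_zero_of_inner_tmul {E F : Type*} [NormedAddCommGroup E] [InnerProductSpace ℂ E]
    [NormedAddCommGroup F] [InnerProductSpace ℂ F] {v : HilbertTensor E F}
    (h : ∀ x y, ⟪((x ⊗ₜ[ℂ] y : E ⊗[ℂ] F) : HilbertTensor E F), v⟫_ℂ = 0) : v = 0 := by
  refine ext_inner_left ℂ fun w => ?_
  rw [inner_zero_right]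
  induction w using UniformSpace.Completion.induction_on with
  | hp => exact isClosed_eq (by fun_prop) (by fun_prop)
  | ih w =>
    induction w using TensorProduct.induction_on with
    | zero => exact inner_zero_left v
    | add x y hx hy => rw [UniformSpace.Completion.coe_add, inner_add_left, hx, hy, add_zero]
    | tmul x y => exact h x y

/-- The operator `y ↦ x ⊗ y`; its adjoint is the slice map at `x`. -/
def tmulLeft {E : Type*} (F : Type*) [NormedAddCommGroup E] [InnerProductSpace ℂ E]
    [NormedAddCommGroup F] [InnerProductSpace ℂ F] (x : E) : F →L[ℂ] HilbertTensor E F :=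
  UniformSpace.Completion.toComplL.comp
    ((TensorProduct.mk ℂ E F x).mkContinuous ‖x‖ fun y => by simp)

lemma tmulLeft_apply {E F : Type*} [NormedAddCommGroup E] [InnerProductSpace ℂ E]
    [NormedAddCommGroup F] [InnerProductSpace ℂ F] (x : E) (y : F) :
    tmulLeft F x y = ((x ⊗ₜ[ℂ] y : E ⊗[ℂ] F) : HilbertTensor E F) := rfl

/-- The commutators `1 ⊗ [a, b]`, with `a`, `b` in a noncommutative invariant subalgebra of an
ergodic algebra `N`, have no common kernel in `L²(M) ⊗ L²(N)`. -/
lemma eq_zero_of_inclRight_commutators (hN : N.IsErgodic) {A : VonNeumannAlgebra K}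
    (hA : N.IsInvariantSubalgebra A) (hnc : ∃ a ∈ A, ∃ b ∈ A, a * b ≠ b * a) {v : ProdL2 M N}
    (hv : ∀ a b : N.Elem, (a : K →L[ℂ] K) ∈ A → (b : K →L[ℂ] K) ∈ A →
      inclRight M N (a * b - b * a) v = 0) : v = 0 := by
  refine eq_zero_of_inner_tmul fun x y => ?_
  have hslice : ∀ c : N.Elem, N.leftMul c ((tmulLeft N.L2 x).adjoint v) =
      (tmulLeft N.L2 x).adjoint (inclRight M N c v) := by
    intro c
    refine ext_inner_left ℂ fun z => ?_
    rw [← N.leftMul c |>.adjoint_inner_left, ContinuousLinearMap.adjoint_inner_right,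
      ContinuousLinearMap.adjoint_inner_right, ← (inclRight M N c).adjoint_inner_left]
    congr 1
    rw [← ContinuousLinearMap.star_eq_adjoint, ← ContinuousLinearMap.star_eq_adjoint, inclRight,
      star_opTensor, tmulLeft_apply, tmulLeft_apply, opTensor_coe]
    simp
  obtain ⟨V, hV, hVa⟩ := N.exists_isometry_lp
  have h0 : V 0 = 0 := norm_eq_zero.1 (by rw [hV, norm_zero])
  have key : (tmulLeft N.L2 x).adjoint v = 0 := by
    rw [← norm_eq_zero, ← hV, norm_eq_zero]
    ext n
    refine N.eq_zero_of_commutators_apply_eq_zero hN hA hnc fun a ha b hb => ?_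
    have h1 := hVa (⟨a, hA.1 ha⟩ * ⟨b, hA.1 hb⟩ - ⟨b, hA.1 hb⟩ * ⟨a, hA.1 ha⟩)
      ((tmulLeft N.L2 x).adjoint v) n
    rw [hslice, hv _ _ ha hb, map_zero, h0] at h1
    exact h1.symm
  rw [← tmulLeft_apply, ← ContinuousLinearMap.adjoint_inner_right, key, inner_zero_right]

lemma star_inclLeft (m : M.Elem) : star (inclLeft M N m) = inclLeft M N (star m) := by
  rw [inclLeft, star_opTensor, M.star_leftMul, star_one, inclLeft]

lemma star_inclRight (n : N.Elem) : star (inclRight M N n) = inclRight M N (star n) := by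
  rw [inclRight, star_opTensor, N.star_leftMul, star_one, inclRight]

lemma inclLeft_comm (hM : M.IsAbelian) (m m' : M.Elem) :
    inclLeft M N m * inclLeft M N m' = inclLeft M N m' * inclLeft M N m := by
  simp only [inclLeft, ← opTensor_mul, ← M.leftMul_mul, hM m m']

lemma inclLeft_mul_inclRight (m : M.Elem) (n : N.Elem) :
    inclLeft M N m * inclRight M N n = inclRight M N n * inclLeft M N m := by
  simp only [inclLeft, inclRight, ← opTensor_mul, one_mul, mul_one]

lemma inclLeft_mem_prodSubalg (A : VonNeumannAlgebra K) (m : M.Elem) :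
    inclLeft M N m ∈ prodSubalg M N A :=
  subset_generated _ (Or.inl ⟨_, ⟨m, rfl⟩, rfl⟩)

lemma inclRight_mem_prodSubalg {A : VonNeumannAlgebra K} {n : N.Elem}
    (hn : (n : K →L[ℂ] K) ∈ A) : inclRight M N n ∈ prodSubalg M N A :=
  subset_generated _ (Or.inr ⟨_, ⟨n, hn, rfl⟩, rfl⟩)

lemma inclLeft_mem_prodAlg (m : M.Elem) : inclLeft M N m ∈ prodAlg M N :=
  subset_generated _ (Or.inl ⟨_, ⟨m, rfl⟩, rfl⟩)

lemma inclRight_mem_prodAlg (n : N.Elem) : inclRight M N n ∈ prodAlg M N :=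
  subset_generated _ (Or.inr ⟨_, ⟨n, rfl⟩, rfl⟩)

lemma prodSubalg_comm (hM : M.IsAbelian) {A : VonNeumannAlgebra K}
    (hA : ∀ a ∈ A, ∀ b ∈ A, a * b = b * a) {x y : ProdL2 M N →L[ℂ] ProdL2 M N}
    (hx : x ∈ prodSubalg M N A) (hy : y ∈ prodSubalg M N A) : x * y = y * x := by
  refine generated_comm ?_ ?_ hx hy
  · rintro _ (⟨_, ⟨m, rfl⟩, rfl⟩ | ⟨_, ⟨n, hn, rfl⟩, rfl⟩)
    · exact Or.inl ⟨_, ⟨star m, rfl⟩, (star_inclLeft M N m).symm⟩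
    · exact Or.inr ⟨_, ⟨star n, star_mem (show (n : K →L[ℂ] K) ∈ A from hn), rfl⟩,
        (star_inclRight M N n).symm⟩
  · rintro _ (⟨_, ⟨m, rfl⟩, rfl⟩ | ⟨_, ⟨n, hn, rfl⟩, rfl⟩) _
      (⟨_, ⟨m', rfl⟩, rfl⟩ | ⟨_, ⟨n', hn', rfl⟩, rfl⟩)
    · exact inclLeft_comm M N hM m m'
    · exact inclLeft_mul_inclRight M N m n'
    · exact (inclLeft_mul_inclRight M N m' n).symm
    · have : n * n' = n' * n := Subtype.ext (hA _ hn _ hn')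
      change inclRight M N n * inclRight M N n' = inclRight M N n' * inclRight M N n
      simp only [inclRight, ← opTensor_mul, ← N.leftMul_mul, this]

/-- If `N` is ergodic and noncommutative, then the ideal `q (M ⊗̄ N)` is commutative only if
`q = 0`: commutativity gives `q² (1 ⊗ [a, b]) = 0` for all `a`, `b` in `N`. -/
lemma eq_zero_of_principalIdeal_comm (hN : N.IsErgodic) (hNnonab : ¬ N.IsAbelian)
    {q : ProdL2 M N →L[ℂ] ProdL2 M N} (hq : IsCentral M N q)
    (hcomm : ∀ x ∈ principalIdeal M N q, ∀ y ∈ principalIdeal M N q, x * y = y * x) : q = 0 := by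
  have hnc : ∃ a ∈ N.alg, ∃ b ∈ N.alg, a * b ≠ b * a := by
    by_contra! h
    exact hNnonab fun x y => Subtype.ext (h x x.2 y y.2)
  have hqq : q * q = 0 := by
    refine ContinuousLinearMap.ext fun v => eq_zero_of_inclRight_commutators M N hN
      (A := N.alg) ⟨le_rfl, fun g x _ => (N.act g x).2⟩ hnc fun a b _ _ => ?_
    have h1 := hcomm _ ⟨_, inclRight_mem_prodAlg M N a, rfl⟩ _ ⟨_, inclRight_mem_prodAlg M N b, rfl⟩
    have ha : Commute q (inclRight M N a) := hq.2 _ (inclRight_mem_prodAlg M N a)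
    have hb : Commute q (inclRight M N b) := hq.2 _ (inclRight_mem_prodAlg M N b)
    change (inclRight M N (a * b - b * a) * (q * q)) v = 0
    have h2 : inclRight M N (a * b - b * a) * (q * q) = 0 := by
      rw [inclRight_commutator, sub_mul, sub_eq_zero]
      simp only [mul_assoc, ha.symm.left_comm, hb.symm.left_comm, ha.symm.eq, hb.symm.eq] at h1 ⊢
      exact h1
    rw [h2, zero_apply]
  exact eq_zero_of_mul_self_eq_zero (hq.2 _ (star_mem hq.1)).symm hqq

end Product

end ErgodicVNA

end

theorem theorem1p5
    {G : Type*} [Group G]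
    {H : Type*} [NormedAddCommGroup H] [InnerProductSpace ℂ H] [CompleteSpace H]
    {K : Type*} [NormedAddCommGroup K] [InnerProductSpace ℂ K] [CompleteSpace K]
    (M : ErgodicVNA.TracialGAlgebra G H) (N : ErgodicVNA.TracialGAlgebra G K)
    (hM : M.IsErgodic) (hN : N.IsErgodic)
    (hMab : M.IsAbelian) (hNnonab : ¬ N.IsAbelian)
    (q : ErgodicVNA.ProdL2 M N →L[ℂ] ErgodicVNA.ProdL2 M N)
    (hq : ErgodicVNA.IsCentral M N q)
    (hqinv : ErgodicVNA.IsInvariantSet M N (ErgodicVNA.principalIdeal M N q))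
    (hq0 : ErgodicVNA.principalIdeal M N q ≠ {0})
    (hq1 : ErgodicVNA.principalIdeal M N q ≠ ErgodicVNA.prodAlg M N) :
    ¬ ErgodicVNA.Splits M N
        (ErgodicVNA.intermediate M N (ErgodicVNA.principalIdeal M N q)) := by
  open ErgodicVNA in
  rintro ⟨A, hA, hV⟩
  have hmem : ∀ x, x ∈ prodSubalg M N A ↔
      ∃ m : M.Elem, ∃ y ∈ prodAlg M N, x = inclLeft M N m + q * y := by
    intro x
    rw [← SetLike.mem_coe, ← hV]
    constructor
    · rintro ⟨m, _, ⟨y, hy, rfl⟩, rfl⟩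
      exact ⟨m, y, hy, rfl⟩
    · rintro ⟨m, y, hy, rfl⟩
      exact ⟨m, _, ⟨y, hy, rfl⟩, rfl⟩
  have hIR : ∀ y ∈ prodAlg M N, q * y ∈ prodSubalg M N A := by
    intro y hy
    have := sub_mem ((hmem _).2 ⟨0, y, hy, rfl⟩) (inclLeft_mem_prodSubalg M N A 0)
    rwa [add_sub_cancel_left] at this
  by_cases hnc : ∃ a ∈ A, ∃ b ∈ A, a * b ≠ b * a
  swap
  · push Not at hnc
    have hq' : q = 0 := by
      refine eq_zero_of_principalIdeal_comm M N hN hNnonab hq ?_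
      rintro _ ⟨x, hx, rfl⟩ _ ⟨y, hy, rfl⟩
      exact prodSubalg_comm M N hMab hnc (hIR x hx) (hIR y hy)
    refine hq0 (Set.eq_singleton_iff_unique_mem.2 ⟨⟨0, zero_mem _, (mul_zero q).symm⟩, ?_⟩)
    rintro _ ⟨x, -, rfl⟩
    rw [hq', zero_mul]
  have hD := fun v => eq_zero_of_inclRight_commutators (v := v) M N hN hA hnc
  -- the quotient by `q (M ⊗̄ N)` is a quotient of `M`, so commutators are multiples of `q`
  have hinj : ∀ v, q v = 0 → v = 0 := by
    refine fun v hv => hD v fun a b ha hb => ?_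
    obtain ⟨m, x, hx, ea⟩ := (hmem _).1 (inclRight_mem_prodSubalg M N ha)
    obtain ⟨n, y, hy, eb⟩ := (hmem _).1 (inclRight_mem_prodSubalg M N hb)
    have hm := inclLeft_mem_prodAlg M N m
    have hn := inclLeft_mem_prodAlg M N n
    rw [inclRight_commutator, ea, eb, commutator_add_mul (hq.2 _ hm) (hq.2 _ hn) (hq.2 x hx)
      (hq.2 y hy) (inclLeft_comm M N hMab m n), hq.2, mul_apply_eq_comp, hv, map_zero]
    exact add_mem (add_mem (sub_mem (mul_mem hm hy) (mul_mem hy hm))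
      (sub_mem (mul_mem hx hn) (mul_mem hn hx)))
      (mul_mem hq.1 (sub_mem (mul_mem hx hy) (mul_mem hy hx)))
  -- an operator commuting with `q` and with `q * x` commutes with `x`, since `q` is injective
  have hPR : ∀ x ∈ prodAlg M N, x ∈ prodSubalg M N A := by
    refine fun x hx => VonNeumannAlgebra.mem_of_forall_commute fun y hy => ?_
    rw [VonNeumannAlgebra.mem_commutant_iff] at hy
    have h1 := hy _ (hIR x hx)
    have h2 : q * y = y * q := hy q (by simpa using hIR 1 (one_mem _))
    refine sub_eq_zero.1 (ContinuousLinearMap.ext fun v => hinj _ ?_)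
    change (q * (y * x - x * y)) v = 0
    rw [mul_sub, ← mul_assoc, ← mul_assoc, h2, mul_assoc, ← h1, sub_self, zero_apply]
  obtain ⟨C, hC, hw⟩ := exists_bound_commutator hq.1 hq.2
    (A := generated (Set.range (inclLeft M N)))
    (generated_le (Set.range_subset_iff.2 (inclLeft_mem_prodAlg M N)))
    (fun x hx y hy => generated_comm
      (by rintro _ ⟨m, rfl⟩; exact ⟨star m, (star_inclLeft M N m).symm⟩)
      (by rintro _ ⟨m, rfl⟩ _ ⟨n, rfl⟩; exact inclLeft_comm M N hMab m n) hx hy)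
    (fun x hx => by
      obtain ⟨m, y, hy, e⟩ := (hmem x).1 (hPR x hx)
      exact ⟨_, subset_generated _ ⟨m, rfl⟩, y, hy, e⟩)
  obtain ⟨r, hr, hqr⟩ := exists_mul_eq_one hq.1 hq.2 hC hw fun v hv => hD v fun a b _ _ => by
    rw [inclRight_commutator]
    exact hv _ (inclRight_mem_prodAlg M N a) _ (inclRight_mem_prodAlg M N b)
  refine hq1 (Set.Subset.antisymm ?_ fun x hx => ⟨r * x, mul_mem hr hx, ?_⟩)
  · rintro _ ⟨x, hx, rfl⟩
    exact mul_mem hq.1 hx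
  · rw [← mul_assoc, hqr, one_mul]
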